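/- A 4-tangle diagram $t$ is a diagram in a disk $D\subset S^2$ with four endpoints on $\partial D$; it is classical if it has no virtual crossings. Let $n(t)$ and $d(t)$ be the link diagrams obtained by joining the ends of $t$ outside $D$ by two disjoint arcs, which join the two top ends and the two bottom ends for the numerator closure $n(t)$, and the two left-hand ends and the two right-hand ends for the denominator closure $d(t)$. Let $t^v$ be the virtual link diagram obtained by joining opposite ends of $t$ outside $D$ by two arcs that meet in a single virtual crossing. For a (virtual) link diagram $\ell$, let $\langle \ell\rangle\in\mathbb{Z}[A^{\pm1}]$ denote its Kauffman bracket, that is $$\langle \ell\rangle=\sum_s A^{a(s)-b(s)}\,(-A^2-A^{-2})^{m(s)-1},$$ where $s$ runs over all ways to choose the $A$- or the $A^{-1}$-smoothing at each classical crossing, $a(s)$ and $b(s)$ are the numbers of $A$- and $A^{-1}$-smoothings in $s$, and $m(s)$ is the number of closed curves obtained (virtual crossings are ignored when these curves are counted). **Proposition.** For every classical 4-tangle diagram $t$, the ideals $$\mathcal{I}_t=\bigl(\langle n(t)\rangle,\langle d(t)\rangle\bigr)\quad\text{and}\quad \mathcal{I}_t^v=\bigl(\langle n(t)\rangle,\langle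 d(t)\rangle,\langle t^v\rangle\bigr)$$ of $\mathbb{Z}[A^{\pm1}]$ are equal. -/

import Mathlib

/-- Half-edges of a diagram drawn on a sphere, with crossing set `C`, set of virtual crossings `V`,
set of two-valent marked points `J`, and `k` endpoints on the boundary circle of the tangle's disk.

* At a crossing, the half-edges `0, 1, 2, 3` are numbered counterclockwise, `0` and `2` being the
  two halves of the under-strand and `1` and `3` the two halves of the over-strand.
* At a virtual crossing, the half-edges `0, 1, 2, 3` are numbered counterclockwise.
* A marked point lies in the interior of a strand and has the two half-edges `0, 1`
  (so that a circle without crossings is an edge joining the two half-edges of a marked point).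
* The endpoints `0, …, k - 1` are numbered counterclockwise along the boundary of the disk; each
  carries one half-edge, which points into the disk. -/
inductive HalfEdge (C V J : Type) (k : ℕ) : Type
  | crossing (c : C) (i : Fin 4)
  | virtual (v : V) (i : Fin 4)
  | joint (j : J) (i : Fin 2)
  | endpoint (i : Fin k)

/-- The combinatorial data of a virtual tangle diagram with `k` endpoints; `k = 0` gives link
diagrams.  The edges of the diagram are the pairs `{x, edge x}` of half-edges.  The diagrams that
are drawn on the sphere (a disk together with its complement) are singled out by
`TangleDiagram.IsPlanar` below. -/
structure TangleDiagram (k : ℕ) where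
  /-- the set of classical crossings -/
  Crossing : Type
  /-- the set of virtual crossings -/
  Virtual : Type
  /-- the set of two-valent marked points -/
  Joint : Type
  [fintypeCrossing : Fintype Crossing]
  [decidableEqCrossing : DecidableEq Crossing]
  [finiteVirtual : Finite Virtual]
  [finiteJoint : Finite Joint]
  /-- the other half of the edge to which a half-edge belongs -/
  edge : HalfEdge Crossing Virtual Joint k → HalfEdge Crossing Virtual Joint k
  edge_edge : ∀ x, edge (edge x) = x
  edge_ne : ∀ x, edge x ≠ x

attribute [instance] TangleDiagram.fintypeCrossing TangleDiagram.decidableEqCrossing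
  TangleDiagram.finiteVirtual TangleDiagram.finiteJoint

namespace TangleDiagram

/-- The type of half-edges of a diagram. -/
abbrev Half {k : ℕ} (t : TangleDiagram k) : Type := HalfEdge t.Crossing t.Virtual t.Joint k

/-- The number of classes of the equivalence relation generated by `r`. -/
noncomputable def numClasses {α : Type} (r : α → α → Prop) : ℕ := Nat.card (Quot r)

/-- The next half-edge, counterclockwise on the sphere, around the same vertex.  The complement of
the disk of the tangle is contracted to a vertex; seen from there, the counterclockwise order of the
endpoints is the reverse of their counterclockwise order along the boundary of the disk. -/
def rotate {k : ℕ} (t : TangleDiagram k) : t.Half → t.Half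
  | .crossing c i => .crossing c (i + 1)
  | .virtual v i => .virtual v (i + 1)
  | .joint j i => .joint j (i + 1)
  | .endpoint i => .endpoint ((finRotate k).symm i)

/-- The number of vertices: crossings, virtual crossings, marked points and, if `k > 0`, the
vertex that stands for the complement of the disk. -/
noncomputable def numVertices {k : ℕ} (t : TangleDiagram k) : ℕ :=
  numClasses fun x y : t.Half => y = t.rotate x

/-- The number of edges. -/
noncomputable def numEdges {k : ℕ} (t : TangleDiagram k) : ℕ :=
  numClasses fun x y : t.Half => y = t.edge x

/-- The number of faces, i.e. of boundary walks of the ribbon surface of the diagram. -/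
noncomputable def numFaces {k : ℕ} (t : TangleDiagram k) : ℕ :=
  numClasses fun x y : t.Half => y = t.rotate (t.edge x)

/-- The number of connected components of the underlying graph. -/
noncomputable def numComponents {k : ℕ} (t : TangleDiagram k) : ℕ :=
  numClasses fun x y : t.Half => y = t.rotate x ∨ y = t.edge x

/-- The diagram is drawn on the sphere: by Euler's formula, `V - E + F` is at most twice the number
of connected components, with equality exactly when every component has genus zero. -/
def IsPlanar {k : ℕ} (t : TangleDiagram k) : Prop :=
  t.numVertices + t.numFaces = t.numEdges + 2 * t.numComponents

/-- A classical tangle diagram: a planar diagram without virtual crossings. -/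
def IsClassical {k : ℕ} (t : TangleDiagram k) : Prop :=
  IsEmpty t.Virtual ∧ t.IsPlanar

/-! ### The Kauffman bracket of a (virtual) link diagram -/

/-- A state `s` of a link diagram chooses a smoothing at each crossing, `true` for the `A`-smoothing
and `false` for the `A⁻¹`-smoothing; `strand s x` is the half-edge by which one leaves a vertex that
one has entered by the half-edge `x`.  The `A`-smoothing merges the two regions that the
over-strand sweeps out when it is turned counterclockwise to the under-strand.  Strands go
straight through virtual crossings. -/
def strand (l : TangleDiagram 0) (s : l.Crossing → Bool) : l.Half → l.Half
  | .crossing c i => .crossing c (if s c then ![1, 0, 3, 2] i else ![3, 2, 1, 0] i)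
  | .virtual v i => .virtual v (i + 2)
  | .joint j i => .joint j (i + 1)
  | .endpoint i => i.elim0

/-- The number of closed curves in the state `s`. -/
noncomputable def numLoops (l : TangleDiagram 0) (s : l.Crossing → Bool) : ℕ :=
  numClasses fun x y : l.Half => y = l.strand s x ∨ y = l.edge x

/-- The Kauffman bracket in `ℤ[A, A⁻¹]`, with `A = T 1`, of a non-empty (virtual) link diagram: the
sum over all states of `A ^ (a - b) * (- A ^ 2 - A ^ (-2)) ^ (m - 1)`, where `a`, `b` and `m` are
the numbers of `A`-smoothings, of `A⁻¹`-smoothings and of closed curves.  The diagram of a single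
circle has bracket `1`. -/
noncomputable def bracket (l : TangleDiagram 0) : LaurentPolynomial ℤ :=
  ∑ s : l.Crossing → Bool,
    LaurentPolynomial.T (∑ c, if s c then (1 : ℤ) else -1) *
      (-LaurentPolynomial.T 2 - LaurentPolynomial.T (-2)) ^ (l.numLoops s - 1)

/-! ### Closures of 4-tangles

The endpoints `0, 1, 2, 3` are the top left, bottom left, bottom right and top right ends. -/

/-- Join the ends of a 4-tangle diagram in pairs by two arcs without crossings.  The arcs are
numbered by `Fin 2`, each contains a marked point, and if `e i = (a, b)`, then the end `i` is
joined to the half-edge `b` of the marked point of arc `a`. -/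
def arcClosure (t : TangleDiagram 4) (e : Fin 4 ≃ Fin 2 × Fin 2) : TangleDiagram 0 :=
  let f : t.Half ≃ HalfEdge t.Crossing t.Virtual (t.Joint ⊕ Fin 2) 0 :=
    { toFun := fun x => match x with
        | .crossing c i => .crossing c i
        | .virtual v i => .virtual v i
        | .joint j i => .joint (.inl j) i
        | .endpoint i => .joint (.inr (e i).1) (e i).2
      invFun := fun x => match x with
        | .crossing c i => .crossing c i
        | .virtual v i => .virtual v i
        | .joint (.inl j) i => .joint j i
        | .joint (.inr a) b => .endpoint (e.symm (a, b))
        | .endpoint i => i.elim0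
      left_inv := by rintro (_ | _ | _ | _) <;> simp
      right_inv := by rintro (_ | _ | ⟨_ | _, _⟩ | i) <;> first | exact i.elim0 | simp }
  { Crossing := t.Crossing
    Virtual := t.Virtual
    Joint := t.Joint ⊕ Fin 2
    edge := fun x => f (t.edge (f.symm x))
    edge_edge := fun x => by simp [t.edge_edge]
    edge_ne := fun x h => t.edge_ne (f.symm x) (by
      simpa using congrArg f.symm h) }

/-- The numerator closure: join the two top ends and the two bottom ends. -/
def numerator (t : TangleDiagram 4) : TangleDiagram 0 :=
  t.arcClosure
    { toFun := ![(0, 0), (1, 0), (1, 1), (0, 1)]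
      invFun := fun p => ![![0, 3], ![1, 2]] p.1 p.2
      left_inv := by decide
      right_inv := by decide }

/-- The denominator closure: join the two left ends and the two right ends. -/
def denominator (t : TangleDiagram 4) : TangleDiagram 0 :=
  t.arcClosure
    { toFun := ![(0, 0), (0, 1), (1, 0), (1, 1)]
      invFun := fun p => ![![0, 1], ![2, 3]] p.1 p.2
      left_inv := by decide
      right_inv := by decide }

/-- The virtual closure: join the ends by two arcs that meet in one virtual crossing and nowhere
else, i.e. fill the complement of the disk with one virtual crossing.  The numbering is reversed
because the endpoints run clockwise around the complement of the disk. -/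
def virtualClosure (t : TangleDiagram 4) : TangleDiagram 0 :=
  let f : t.Half ≃ HalfEdge t.Crossing (Option t.Virtual) t.Joint 0 :=
    { toFun := fun x => match x with
        | .crossing c i => .crossing c i
        | .virtual v i => .virtual (some v) i
        | .joint j i => .joint j i
        | .endpoint i => .virtual none (-i)
      invFun := fun x => match x with
        | .crossing c i => .crossing c i
        | .virtual (some v) i => .virtual v i
        | .virtual none i => .endpoint (-i)
        | .joint j i => .joint j i
        | .endpoint i => i.elim0
      left_inv := by rintro (_ | _ | _ | _) <;> simp
      right_inv := by rintro (_ | ⟨_ | _, _⟩ | _ | i) <;> first | exact i.elim0 | simp }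
  { Crossing := t.Crossing
    Virtual := Option t.Virtual
    Joint := t.Joint
    edge := fun x => f (t.edge (f.symm x))
    edge_edge := fun x => by simp [t.edge_edge]
    edge_ne := fun x h => t.edge_ne (f.symm x) (by
      simpa using congrArg f.symm h) }

/-- The ideal `I_t` of `ℤ[A, A⁻¹]` generated by the brackets of the two closures of a 4-tangle
diagram by arcs without any crossings. -/
noncomputable def bracketIdeal (t : TangleDiagram 4) : Ideal (LaurentPolynomial ℤ) :=
  Ideal.span {t.numerator.bracket, t.denominator.bracket}

/-- The ideal `I_t^v` of `ℤ[A, A⁻¹]` generated by the brackets of the three closures of a 4-tangle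
diagram by arcs without classical crossings. -/
noncomputable def virtualBracketIdeal (t : TangleDiagram 4) : Ideal (LaurentPolynomial ℤ) :=
  Ideal.span {t.numerator.bracket, t.denominator.bracket, t.virtualClosure.bracket}

end TangleDiagram

/-! Put `δ = -A² - A⁻²`. In every state of a classical tangle the open strands join neighbouring
ends. Hence one of the closures `n(t)`, `d(t)` has as many loops as `t^v` and the other has one
more, and summing over states gives `⟨n(t)⟩ + ⟨d(t)⟩ = (δ + 1)⟨t^v⟩`
(`bracket_numerator_add_bracket_denominator`).

Modulo `δ + 1` the power of `δ` in a state sum is only a sign. Changing one smoothing flips the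
parity of the number of loops, so the state sum factors over the crossings and `⟨n(t)⟩` becomes `±(A
- A⁻¹)^c`, with `c` the number of crossings. It is a unit because `(A - A⁻¹)² = -δ - 2 = -1`
(`isUnit_map_bracket_numerator`). So `w⟨n(t)⟩ = 1 + (δ + 1)h` for some `w` and `h`; multiplication
by `⟨t^v⟩` yields `⟨t^v⟩ = w⟨t^v⟩⟨n(t)⟩ - h(⟨n(t)⟩ + ⟨d(t)⟩)`.

Planarity enters only through a checkerboard coloring: signs of half-edges that alternate around
vertices and along edges (`exists_alternating_of_euler`). Smoothings and planar closures join
opposite signs, so loops are the orbits of a permutation of the half-edges of one sign. A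
transposition changes the parity of the number of orbits (`neg_one_pow_numClasses_of_swap`). -/

open Module

/-! ### Alternating signs from Euler's formula, by linear algebra over the field with two elements
-/

/-- The functions on `H` that are invariant under the relation `r`. -/
def invariantFunctions (K : Type) [Semiring K] {H : Type} (r : H → H → Prop) :
    Submodule K (H → K) where
  carrier := {f | ∀ x y, r x y → f x = f y}
  add_mem' hf hg x y h := by simp [hf x y h, hg x y h]
  zero_mem' _ _ _ := rfl
  smul_mem' a f hf x y h := by simp [hf x y h]

/-- Invariant functions are the functions on the set of classes. -/
def invariantFunctionsEquiv (K : Type) [Semiring K] {H : Type} (r : H → H → Prop) :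
    invariantFunctions K r ≃ₗ[K] (Quot r → K) where
  toFun f := Quot.lift f.1 f.2
  invFun g := ⟨fun x => g (Quot.mk r x), fun _ _ h => congrArg g (Quot.sound h)⟩
  left_inv _ := rfl
  right_inv g := by
    funext q
    induction q using Quot.ind
    rfl
  map_add' f g := by
    funext q
    induction q using Quot.ind
    rfl
  map_smul' a f := by
    funext q
    induction q using Quot.ind
    rfl

/-- This turns Euler's formula into an identity between dimensions. -/
theorem finrank_invariantFunctions {H : Type} [Finite H] (r : H → H → Prop) :
    finrank (ZMod 2) (invariantFunctions (ZMod 2) r) = TangleDiagram.numClasses r := by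
  have : Fintype (Quot r) := Fintype.ofFinite _
  rw [(invariantFunctionsEquiv (ZMod 2) r).finrank_eq, finrank_fintype_fun_eq_card,
    TangleDiagram.numClasses, Nat.card_eq_fintype_card]

theorem ZMod.two_eq_add_one_of_add_eq_one {a b : ZMod 2} (h : a + b = 1) : b = a + 1 := by
  revert a b; decide

/-- If the map with vertex rotation `σ` and edge involution `α` satisfies Euler's formula for
genus zero and if all of its vertices have even degree, then its faces can be colored with two
colors; in terms of half-edges, the in-out orientations of the edges alternate around every
vertex. -/
theorem exists_alternating_of_euler {H : Type} [Finite H] {σ α : H → H}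
    (hσ : Function.Injective σ) (hα : ∀ x, α (α x) = x) (hne : ∀ x, α x ≠ x)
    (τ : H → ZMod 2) (hτ : ∀ x, τ (σ x) = τ x + 1)
    (euler : TangleDiagram.numClasses (fun x y => y = σ x) +
        TangleDiagram.numClasses (fun x y => y = σ (α x)) =
      TangleDiagram.numClasses (fun x y => y = α x) +
        2 * TangleDiagram.numClasses (fun x y => y = σ x ∨ y = α x)) :
    ∃ ε : H → ZMod 2, ∀ x, ε (σ x) = ε x + 1 ∧ ε (α x) = ε x + 1 := by
  classical
  have : Fintype H := Fintype.ofFinite H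
  have hσb : Function.Bijective σ := Finite.injective_iff_bijective.1 hσ
  have hαb : Function.Bijective α := (show Function.Involutive α from hα).bijective
  have two : ∀ a : ZMod 2, a + a = 0 := CharTwo.add_self_eq_zero
  simp only [← finrank_invariantFunctions] at euler
  set V := invariantFunctions (ZMod 2) (fun x y => y = σ x)
  set F := invariantFunctions (ZMod 2) (fun x y => y = σ (α x))
  set E := invariantFunctions (ZMod 2) (fun x y => y = α x)
  set C := invariantFunctions (ZMod 2) (fun x y => y = σ x ∨ y = α x)
  have memV : ∀ f, f ∈ V ↔ ∀ x, f (σ x) = f x := fun f =>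
    ⟨fun h x => (h x _ rfl).symm, fun h x y e => by rw [e, h]⟩
  have memF : ∀ f, f ∈ F ↔ ∀ x, f (σ (α x)) = f x := fun f =>
    ⟨fun h x => (h x _ rfl).symm, fun h x y e => by rw [e, h]⟩
  have memE : ∀ f, f ∈ E ↔ ∀ x, f (α x) = f x := fun f =>
    ⟨fun h x => (h x _ rfl).symm, fun h x y e => by rw [e, h]⟩
  have memC : ∀ f, f ∈ C ↔ ∀ x, f (σ x) = f x ∧ f (α x) = f x := fun f =>
    ⟨fun h x => ⟨(h x _ (Or.inl rfl)).symm, (h x _ (Or.inr rfl)).symm⟩,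
      fun h x y e => by rcases e with e | e <;> rw [e] <;> simp [h]⟩
  let D : (H → ZMod 2) →ₗ[ZMod 2] (H → ZMod 2) :=
    LinearMap.id + LinearMap.funLeft (ZMod 2) (ZMod 2) α
  have D_apply : ∀ f x, D f x = f x + f (α x) := fun f x => rfl
  -- a section of the edges
  obtain ⟨u, hu⟩ : ∃ u : H → ZMod 2, ∀ x, u x + u (α x) = 1 := by
    let e := Fintype.equivFin H
    refine ⟨fun x => if e x < e (α x) then 1 else 0, fun x => ?_⟩
    have : e x ≠ e (α x) := fun h => hne x (e.injective h).symm
    rcases lt_or_gt_of_ne this with h | h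
    · simp [hα, h, h.not_gt]
    · simp [hα, h, h.not_gt]
  have kerD : LinearMap.ker D = E := by
    ext f
    rw [LinearMap.mem_ker, memE, funext_iff]
    refine forall_congr' fun x => ?_
    rw [D_apply, Pi.zero_apply, CharTwo.add_eq_zero, eq_comm]
  have rangeD : LinearMap.range D = E := by
    apply le_antisymm
    · rintro _ ⟨f, rfl⟩
      rw [memE]
      intro x
      rw [D_apply, D_apply, hα, add_comm]
    · intro f hf
      rw [memE] at hf
      refine ⟨fun x => u x * f x, funext fun x => ?_⟩
      rw [D_apply, hf, ← add_mul, hu, one_mul]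
  -- Kernel and range of `D` are both `E`.
  have cardH : finrank (ZMod 2) (H → ZMod 2) = finrank (ZMod 2) E + finrank (ZMod 2) E := by
    rw [← LinearMap.finrank_range_add_finrank_ker D, rangeD, kerD]
  have infV : V ⊓ E = C := by
    ext f
    rw [Submodule.mem_inf, memV, memE, memC, forall_and]
  have infF : F ⊓ E = C := by
    ext f
    rw [Submodule.mem_inf, memF, memE, memC]
    refine ⟨fun h x => ⟨?_, h.2 x⟩, fun h => ⟨fun x => ?_, fun x => (h x).2⟩⟩
    · rw [← h.2 x, ← h.1 (α x), hα]
    · rw [(h _).1, (h x).2]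
  have sumσ : ∀ f : H → ZMod 2, ∑ x, f (σ x) = ∑ x, f x := fun f =>
    Function.Bijective.sum_comp hσb f
  have sumα : ∀ f : H → ZMod 2, ∑ x, f (α x) = ∑ x, f x := fun f =>
    Function.Bijective.sum_comp hαb f
  -- the pairing with the coboundaries of the vertices
  let P : (H → ZMod 2) →ₗ[ZMod 2] Dual (ZMod 2) V :=
    LinearMap.mk₂ (ZMod 2) (fun u (h : V) => ∑ x, D u x * h.1 x)
      (fun a b h => by simp [add_mul, Finset.sum_add_distrib])
      (fun c a h => by simp [Finset.mul_sum, mul_assoc])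
      (fun a b h => by simp [mul_add, Finset.sum_add_distrib])
      (fun c a h => by simp [Finset.mul_sum, mul_left_comm])
  have P_apply : ∀ u h, P u h = ∑ x, D u x * h.1 x := fun u h => rfl
  -- `D` is self-adjoint, so the elements of `V` annihilated by the range of `P` are those in `ker D
  -- = E`, and `V ⊓ E = C`.
  have rangeP : finrank (ZMod 2) (LinearMap.range P) + finrank (ZMod 2) C
      = finrank (ZMod 2) V := by
    have h0 : (LinearMap.range P).dualCoannihilator.map V.subtype = C := by
      rw [← infV, ← kerD]
      ext f
      have adj : ∀ u : H → ZMod 2, ∑ x, D u x * f x = ∑ x, u x * D f x := fun u => by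
        simp only [D_apply, add_mul, mul_add, Finset.sum_add_distrib]
        rw [← sumα fun x => u (α x) * f x]
        simp only [hα]
      simp only [Submodule.mem_map, Submodule.mem_dualCoannihilator, LinearMap.mem_range,
        forall_exists_index, forall_apply_eq_imp_iff, Submodule.mem_inf, LinearMap.mem_ker]
      constructor
      · rintro ⟨h, hh, rfl⟩
        refine ⟨h.2, funext fun y => ?_⟩
        have h1 := adj (Pi.single y 1)
        simp only [Submodule.subtype_apply] at h1 ⊢
        rw [← P_apply, hh] at h1
        simpa [Pi.single_apply] using h1.symm
      · rintro ⟨h1, h2⟩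
        refine ⟨⟨f, h1⟩, fun a => ?_, rfl⟩
        rw [P_apply, adj, h2]
        simp
    rw [← h0, Submodule.finrank_map_subtype_eq]
    exact Subspace.finrank_add_finrank_dualCoannihilator_eq _
  have kerP : F ⊔ E ≤ LinearMap.ker P := by
    refine sup_le (fun f hf => ?_) (fun f hf => ?_)
    · rw [memF] at hf
      rw [LinearMap.mem_ker]
      ext ⟨h, hh⟩
      rw [memV] at hh
      have h1 : ∑ x, f (α x) * h x = ∑ x, f x * h x := by
        rw [← sumσ fun x => f x * h x]
        refine Finset.sum_congr rfl fun x _ => ?_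
        rw [hh, ← hf (α x), hα]
      simp only [P_apply, D_apply, add_mul, Finset.sum_add_distrib, h1, two]
      rfl
    · rw [← kerD, LinearMap.mem_ker] at hf
      rw [LinearMap.mem_ker]
      ext h
      simp [P_apply, hf]
  -- Here genus zero is used: Euler's formula makes both dimensions equal to `2 dim E + dim C - dim
  -- V`.
  have kerP_eq : F ⊔ E = LinearMap.ker P := by
    apply Submodule.eq_of_le_of_finrank_le kerP
    have h1 := LinearMap.finrank_range_add_finrank_ker P
    have h2 := Submodule.finrank_sup_add_finrank_inf_eq F E
    rw [infF] at h2
    omega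
  -- Since `D u = 1`, the claim is that every `h` in `V` has sum zero; this holds because the
  -- vertices have even degree, as `τ` witnesses.
  have hPu : u ∈ F ⊔ E := by
    rw [kerP_eq, LinearMap.mem_ker]
    ext ⟨h, hh⟩
    rw [memV] at hh
    have h1 : ∑ x, τ x * h x = ∑ x, τ x * h x + ∑ x, h x := by
      conv_lhs => rw [← sumσ fun x => τ x * h x]
      rw [← Finset.sum_add_distrib]
      refine Finset.sum_congr rfl fun x _ => ?_
      rw [hh, hτ, add_mul, one_mul]
    simp only [P_apply, D_apply, hu, one_mul]
    simpa using h1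
  obtain ⟨f, hf, g, hg, rfl⟩ := Submodule.mem_sup.1 hPu
  rw [memF] at hf
  rw [memE] at hg
  -- The summand `g` is constant on edges, so `f` inherits `D f = 1` from `u`; being constant on
  -- faces, `f` then alternates around vertices as well.
  have key : ∀ x, f (α x) = f x + 1 := fun x => by
    apply ZMod.two_eq_add_one_of_add_eq_one
    rw [← hu x]
    simp only [Pi.add_apply, hg]
    rw [add_add_add_comm, two, add_zero]
  refine ⟨f, fun x => ⟨?_, key x⟩⟩
  rw [← key x, ← hf (α x), hα]

/-! ### Numbers of classes and the sign of a permutation -/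

open TangleDiagram in
theorem numClasses_congr {H H' : Type} {r : H → H → Prop} {r' : H' → H' → Prop} (f : H ≃ H')
    (h : ∀ x y, r x y → Quot.mk r' (f x) = Quot.mk r' (f y))
    (h' : ∀ x y, r' x y → Quot.mk r (f.symm x) = Quot.mk r (f.symm y)) :
    numClasses r = numClasses r' := by
  refine Nat.card_congr ⟨Quot.lift (fun x => Quot.mk r' (f x)) h,
    Quot.lift (fun x => Quot.mk r (f.symm x)) h', ?_, ?_⟩
  · rintro ⟨x⟩
    simp
  · rintro ⟨x⟩
    simp

/-- The relation `r` together with the pair `(a, b)`. -/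
def Relation.adjoin {H : Type} (r : H → H → Prop) (a b : H) : H → H → Prop :=
  fun x y => r x y ∨ x = a ∧ y = b

theorem Relation.adjoin_mk_eq {H : Type} (r : H → H → Prop) (a b : H) :
    Quot.mk (Relation.adjoin r a b) a = Quot.mk (Relation.adjoin r a b) b :=
  Quot.sound (Or.inr ⟨rfl, rfl⟩)

theorem Relation.adjoin_mk_mono {H : Type} {r : H → H → Prop} (a b : H) {x y : H}
    (h : Quot.mk r x = Quot.mk r y) :
    Quot.mk (Relation.adjoin r a b) x = Quot.mk (Relation.adjoin r a b) y :=
  congrArg (Quot.lift (Quot.mk (Relation.adjoin r a b)) fun _ _ h => Quot.sound (Or.inl h)) h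

open TangleDiagram in
theorem numClasses_adjoin_of_eq {H : Type} {r : H → H → Prop} {a b : H}
    (h : Quot.mk r a = Quot.mk r b) : numClasses (Relation.adjoin r a b) = numClasses r := by
  refine numClasses_congr (Equiv.refl H) (fun x y hxy => ?_) (fun x y hxy => ?_)
  · rcases hxy with hxy | ⟨rfl, rfl⟩
    · exact Quot.sound hxy
    · exact h
  · exact Quot.sound (Or.inl hxy)

open TangleDiagram in
theorem numClasses_adjoin_of_ne {H : Type} [Finite H] {r : H → H → Prop} {a b : H}
    (h : Quot.mk r a ≠ Quot.mk r b) : numClasses (Relation.adjoin r a b) + 1 = numClasses r := by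
  classical
  have : Fintype (Quot r) := Fintype.ofFinite _
  -- The class of `b` is absorbed into that of `a`; all other classes stay.
  have e : Quot (Relation.adjoin r a b) ≃ {q : Quot r // q ≠ Quot.mk r b} :=
    { toFun := Quot.lift
        (fun x => if hx : Quot.mk r x = Quot.mk r b then ⟨Quot.mk r a, h⟩ else ⟨Quot.mk r x, hx⟩)
        (by
          rintro x y (hxy | ⟨rfl, rfl⟩)
          · simp only [Quot.sound hxy]
          · simp [h])
      invFun := fun q => Quot.lift (Quot.mk (Relation.adjoin r a b))
        (fun _ _ h => Quot.sound (Or.inl h)) q.1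
      left_inv := by
        rintro ⟨x⟩
        by_cases hx : Quot.mk r x = Quot.mk r b
        · simp only [hx, dite_true]
          exact (Relation.adjoin_mk_eq r a b).trans (Relation.adjoin_mk_mono a b hx).symm
        · simp only [hx, dite_false]
      right_inv := by
        rintro ⟨⟨x⟩, hx⟩
        exact dif_neg hx }
  rw [numClasses, numClasses, Nat.card_congr e, Nat.card_eq_fintype_card,
    Nat.card_eq_fintype_card, Fintype.card_subtype_compl, Fintype.card_subtype_eq]
  have : 0 < Fintype.card (Quot r) := Fintype.card_pos_iff.2 ⟨Quot.mk r b⟩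
  omega

open TangleDiagram in
/-- The sign of a permutation in terms of its number of orbits. -/
theorem Equiv.Perm.sign_eq_neg_one_pow_numClasses {α : Type} [Fintype α] [DecidableEq α]
    (f : Equiv.Perm α) :
    Equiv.Perm.sign f = (-1 : ℤˣ) ^ (Fintype.card α + numClasses fun x y => y = f x) := by
  -- A label of the orbit of `x`: its nontrivial cycle, or the fixed point itself.
  let g : α → Equiv.Perm α ⊕ α := fun x => if x ∈ f.support then .inl (f.cycleOf x) else .inr x
  have hg : ∀ x, g x ∈ f.cycleFactorsFinset.disjSum f.supportᶜ := fun x => by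
    by_cases hx : x ∈ f.support
    · simp only [g, hx, if_true, Finset.inl_mem_disjSum]
      exact Equiv.Perm.cycleOf_mem_cycleFactorsFinset_iff.2 hx
    · simp only [g, hx, if_false, Finset.inr_mem_disjSum, Finset.mem_compl, not_false_eq_true]
  have hgf : ∀ x, g (f x) = g x := fun x => by
    by_cases hx : x ∈ f.support
    · have hx' := Equiv.Perm.apply_mem_support.2 hx
      simp only [g, hx, hx', if_true]
      rw [(Equiv.Perm.sameCycle_iff_cycleOf_eq_of_mem_support hx' hx).1]
      exact Equiv.Perm.sameCycle_apply_left.2 (Equiv.Perm.SameCycle.refl f x)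
    · rw [Equiv.Perm.notMem_support.1 hx]
  have hpow : ∀ (x : α) (n : ℕ), Quot.mk (fun x y => y = f x) ((f ^ n) x) = Quot.mk _ x := by
    intro x n
    induction n with
    | zero => rfl
    | succ n ih =>
      rw [pow_succ', Equiv.Perm.mul_apply, ← ih]
      exact (Quot.sound (r := fun x y => y = f x) rfl).symm
  have hsame : ∀ x y, f.SameCycle x y → Quot.mk (fun x y => y = f x) x = Quot.mk _ y := by
    intro x y h
    obtain ⟨n, -, rfl⟩ := h.exists_pow_eq'
    exact (hpow x n).symm
  have card : numClasses (fun x y => y = f x) =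
      (f.cycleFactorsFinset.disjSum f.supportᶜ).card := by
    rw [numClasses, ← Fintype.card_coe, ← Nat.card_eq_fintype_card]
    refine Nat.card_eq_of_bijective
      (Quot.lift (fun x => ⟨g x, hg x⟩) fun x y h => by subst h; simp only [hgf]) ⟨?_, ?_⟩
    · rintro ⟨x⟩ ⟨y⟩ hxy
      apply hsame
      have hxy : g x = g y := congrArg Subtype.val hxy
      by_cases hx : x ∈ f.support <;> by_cases hy : y ∈ f.support <;>
        simp only [g, hx, hy, if_true, if_false, Sum.inl.injEq, Sum.inr.injEq, reduceCtorEq] at hxy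
      · exact (Equiv.Perm.sameCycle_iff_cycleOf_eq_of_mem_support hx hy).2 hxy
      · exact hxy ▸ Equiv.Perm.SameCycle.refl f x
    · rintro ⟨c | x, hc⟩
      · rw [Finset.inl_mem_disjSum] at hc
        obtain ⟨a, ha⟩ := (Equiv.Perm.mem_cycleFactorsFinset_iff.1 hc).1.nonempty_support
        refine ⟨Quot.mk _ a, Subtype.ext ?_⟩
        simp only [g, Equiv.Perm.mem_cycleFactorsFinset_support_le hc ha, if_true,
          ← Equiv.Perm.cycle_is_cycleOf ha hc]
      · rw [Finset.inr_mem_disjSum, Finset.mem_compl] at hc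
        exact ⟨Quot.mk _ x, Subtype.ext (if_neg hc)⟩
  rw [Equiv.Perm.sign_of_cycleType, Equiv.Perm.sum_cycleType, card, Finset.card_disjSum,
    ← Finset.card_compl_add_card f.support, Equiv.Perm.cycleType_def, Multiset.card_map]
  change (-1 : ℤˣ) ^ (f.support.card + f.cycleFactorsFinset.card) = _
  -- Each fixed point counts once as an element and once as an orbit, hence does not affect the
  -- sign.
  rw [show f.supportᶜ.card + f.support.card + (f.cycleFactorsFinset.card + f.supportᶜ.card) =
    f.support.card + f.cycleFactorsFinset.card + 2 * f.supportᶜ.card by ring, pow_add _ _ (2 * _),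
    pow_mul]
  simp

/-! ### Loops formed by two sign-reversing involutions -/

theorem ZMod.two_ne_add_one (a : ZMod 2) : a + 1 ≠ a := by
  revert a; decide

theorem ZMod.two_eq_or_eq_add_one (a b : ZMod 2) : a = b ∨ a = b + 1 := by
  revert a b; decide

theorem ZMod.two_add_one_add_one (a : ZMod 2) : a + 1 + 1 = a := by
  revert a; decide

/-- A fixed-point free involution of a set of half-edges that reverses the sign `ε`. -/
structure IsReversing {H : Type} (ε : H → ZMod 2) (s : H → H) : Prop where
  invol : ∀ x, s (s x) = x
  reverse : ∀ x, ε (s x) = ε x + 1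

/-- The permutation `e ∘ s` of the half-edges of a given sign. -/
def loopPerm {H : Type} {ε : H → ZMod 2} {e s : H → H} (he : IsReversing ε e)
    (hs : IsReversing ε s) (i : ZMod 2) : Equiv.Perm {x // ε x = i} where
  toFun x := ⟨e (s x), by rw [he.reverse, hs.reverse, x.2, ZMod.two_add_one_add_one]⟩
  invFun x := ⟨s (e x), by rw [hs.reverse, he.reverse, x.2, ZMod.two_add_one_add_one]⟩
  left_inv x := by simp [he.invol, hs.invol]
  right_inv x := by simp [he.invol, hs.invol]

open TangleDiagram in
-- Signs alternate along a loop, so its half-edges of sign `i` form a single orbit of `e ∘ s`. On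
-- all half-edges, each loop would give two orbits.
theorem numClasses_loopPerm {H : Type} {ε : H → ZMod 2} {e s : H → H} (he : IsReversing ε e)
    (hs : IsReversing ε s) (i : ZMod 2) :
    numClasses (fun x y : H => y = s x ∨ y = e x) =
      numClasses fun x y => y = loopPerm he hs i x := by
  classical
  let r := fun x y : H => y = s x ∨ y = e x
  let r' := fun x y => y = loopPerm he hs i x
  have hc : ∀ {x}, ε x ≠ i → ε x = i + 1 := fun h =>
    (ZMod.two_eq_or_eq_add_one _ _).resolve_left h
  have he' : ∀ {x}, ε x ≠ i → ε (e x) = i := fun h => by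
    rw [he.reverse, hc h, ZMod.two_add_one_add_one]
  let g : H → Quot r' := fun x =>
    if h : ε x = i then Quot.mk r' ⟨x, h⟩ else Quot.mk r' ⟨e x, he' h⟩
  have ge : ∀ x, ε x = i → g (e x) = g x := fun x h => by
    have h' : ε (e x) ≠ i := by rw [he.reverse, h]; exact ZMod.two_ne_add_one i
    simp only [g, h, h', dite_true, dite_false, he.invol]
  have gs : ∀ x, ε x = i → g (s x) = g x := fun x h => by
    have h' : ε (s x) ≠ i := by rw [hs.reverse, h]; exact ZMod.two_ne_add_one i
    simp only [g, h, h', dite_true, dite_false]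
    exact (Quot.sound (r := r') (a := ⟨x, h⟩) rfl).symm
  refine Nat.card_congr ⟨Quot.lift g ?_, Quot.lift (fun x => Quot.mk r x.1) ?_, ?_, ?_⟩
  · rintro x y (rfl | rfl) <;> by_cases h : ε x = i
    · exact (gs x h).symm
    · rw [← gs (s x) (by rw [hs.reverse, hc h, ZMod.two_add_one_add_one]), hs.invol]
    · exact (ge x h).symm
    · rw [← ge (e x) (he' h), he.invol]
  · rintro x y rfl
    exact (Quot.sound (r := r) (Or.inl rfl)).trans (Quot.sound (r := r) (Or.inr rfl))
  · rintro ⟨x⟩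
    by_cases h : ε x = i
    · simp only [g, h, dite_true]
      rfl
    · simp only [g, h, dite_false]
      exact (Quot.sound (r := r) (Or.inr rfl)).symm
  · rintro ⟨x, h⟩
    simp only [g, h, dite_true]
    rfl

open TangleDiagram in
/-- Exchanging the images under `s` of two half-edges of the same sign changes the number of loops
by an odd number. -/
theorem neg_one_pow_numClasses_of_swap {H : Type} [Finite H] [DecidableEq H] {ε : H → ZMod 2}
    {e s s' : H → H} (he : IsReversing ε e) (hs : IsReversing ε s) (hs' : IsReversing ε s')
    {a b : H} (hab : a ≠ b) (hε : ε b = ε a)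
    (h : ∀ x, ε x = ε a → s' x = s (Equiv.swap a b x)) :
    (-1 : ℤˣ) ^ numClasses (fun x y : H => y = s' x ∨ y = e x) =
      -(-1) ^ numClasses (fun x y : H => y = s x ∨ y = e x) := by
  have : Fintype H := Fintype.ofFinite H
  have hmul : loopPerm he hs' (ε a) = loopPerm he hs (ε a) * Equiv.swap ⟨a, rfl⟩ ⟨b, hε⟩ := by
    ext ⟨x, hx⟩
    have h1 : ((Equiv.swap ⟨a, rfl⟩ ⟨b, hε⟩ : Equiv.Perm {x // ε x = ε a}) ⟨x, hx⟩).1 =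
        Equiv.swap a b x := by
      simp only [Equiv.swap_apply_def, Subtype.mk.injEq]
      split_ifs <;> rfl
    simp only [loopPerm, Equiv.coe_fn_mk, Equiv.Perm.mul_apply, h1, h x hx]
  have hsign := congrArg Equiv.Perm.sign hmul
  rw [Equiv.Perm.sign_mul, Equiv.Perm.sign_swap (by simpa using hab),
    Equiv.Perm.sign_eq_neg_one_pow_numClasses, Equiv.Perm.sign_eq_neg_one_pow_numClasses,
    ← numClasses_loopPerm, ← numClasses_loopPerm, pow_add, pow_add, mul_assoc] at hsign
  simpa using mul_left_cancel hsign

/-- The terms of `x` and `s x` cancel. -/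
theorem sum_signed_eq_zero {H : Type} [Fintype H] {ε : H → ZMod 2} {s : H → H}
    (hs : IsReversing ε s) (k : H → ℤ) (hk : ∀ x, k (s x) = k x) :
    ∑ x, (if ε x = 0 then k x else -k x) = 0 := by
  have h := Function.Bijective.sum_comp (show Function.Involutive s from hs.invol).bijective
    fun x => if ε x = 0 then k x else -k x
  have h' : ∀ x, (if ε (s x) = 0 then k (s x) else -k (s x)) =
      -(if ε x = 0 then k x else -k x) := fun x => by
    rw [hs.reverse, hk]
    rcases ZMod.two_eq_or_eq_add_one (ε x) 0 with h | h <;> simp [h, CharTwo.add_self_eq_zero]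
  simp only [h', Finset.sum_neg_distrib] at h
  omega

/-- The ends of the open strands formed by `e` and by the restriction of `s` to the complement of
four points `p 0, …, p 3` of alternating signs are balanced in every class of strands. -/
theorem balanced_ends {H : Type} [Finite H] {ε : H → ZMod 2} {e s : H → H}
    (he : IsReversing ε e) (hs : IsReversing ε s) {p : Fin 4 → H} (hp : Function.Injective p)
    (hsp : ∀ x, s x ∈ Set.range p ↔ x ∈ Set.range p) (hε : ∀ i, ε (p (i + 1)) = ε (p i) + 1)
    (k : H → ℤ) (hke : ∀ x, k (e x) = k x) (hks : ∀ x, x ∉ Set.range p → k (s x) = k x) :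
    k (p 0) + k (p 2) = k (p 1) + k (p 3) := by
  classical
  have : Fintype H := Fintype.ofFinite H
  have h1 := sum_signed_eq_zero he k hke
  have h2 := sum_signed_eq_zero hs (fun x => if x ∈ Set.range p then 0 else k x) (fun x => by
    simp only [hsp]
    split_ifs with h
    · rfl
    · exact hks x h)
  -- The difference of the two vanishing sums is supported on the four points.
  have h3 : ∑ i : Fin 4, (if ε (p i) = 0 then k (p i) else -k (p i)) = 0 := by
    rw [Fintype.sum_of_injective p hp _ (fun x =>
      (if ε x = 0 then k x else -k x) - (if ε x = 0 then (if x ∈ Set.range p then 0 else k x)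
        else -(if x ∈ Set.range p then 0 else k x))) (fun x hx => by simp only [hx, if_false, sub_self])
      (fun i => by simp), Finset.sum_sub_distrib, h1, h2, sub_zero]
  have e1 := hε 0
  have e2 := hε 1
  have e3 := hε 2
  simp only [Fin.reduceAdd, zero_add] at e1 e2 e3
  rw [Fin.sum_univ_four, e3, e2, e1, ZMod.two_add_one_add_one] at h3
  rcases ZMod.two_eq_or_eq_add_one (ε (p 0)) 0 with h | h <;>
    simp [h, CharTwo.add_self_eq_zero] at h3 <;> omega

open TangleDiagram Relation in
/-- The numbers of loops of the three closures of a system of open strands with four ends, two of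
which are joined to the two others. -/
theorem numClasses_adjoin_of_paired {H : Type} [Finite H] {r : H → H → Prop} {a b c d : H}
    (hab : Quot.mk r a = Quot.mk r b) (hcd : Quot.mk r c = Quot.mk r d)
    (hne : numClasses (adjoin (adjoin r a d) b c) ≠ numClasses (adjoin (adjoin r a b) c d)) :
    numClasses (adjoin (adjoin r a d) b c) = numClasses (adjoin (adjoin r a c) b d) ∧
      numClasses (adjoin (adjoin r a b) c d) = numClasses (adjoin (adjoin r a c) b d) + 1 := by
  rw [numClasses_adjoin_of_eq (adjoin_mk_mono _ _ hcd), numClasses_adjoin_of_eq hab,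
    numClasses_adjoin_of_eq (((adjoin_mk_mono _ _ hab).symm.trans (adjoin_mk_eq _ _ _)).trans
      (adjoin_mk_mono _ _ hcd).symm)] at *
  rw [numClasses_adjoin_of_eq (((adjoin_mk_mono _ _ hab).symm.trans (adjoin_mk_eq _ _ _)).trans
      (adjoin_mk_mono _ _ hcd))]
  -- If all four ends were in one class, no added pair would merge anything, against `hne`.
  have hac : Quot.mk r a ≠ Quot.mk r c := fun h =>
    hne (numClasses_adjoin_of_eq (h.trans hcd))
  have h1 := numClasses_adjoin_of_ne hac
  have h2 := numClasses_adjoin_of_ne (hcd ▸ hac)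
  omega

/-! ### States of a 4-tangle and of its closures -/

namespace TangleDiagram

/-- The half-edges of a diagram as a sum type. -/
def _root_.HalfEdge.equivSum (C V J : Type) (k : ℕ) :
    HalfEdge C V J k ≃ ((C × Fin 4) ⊕ (V × Fin 4)) ⊕ ((J × Fin 2) ⊕ Fin k) where
  toFun
    | .crossing c i => .inl (.inl (c, i))
    | .virtual v i => .inl (.inr (v, i))
    | .joint j i => .inr (.inl (j, i))
    | .endpoint i => .inr (.inr i)
  invFun
    | .inl (.inl (c, i)) => .crossing c i
    | .inl (.inr (v, i)) => .virtual v i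
    | .inr (.inl (j, i)) => .joint j i
    | .inr (.inr i) => .endpoint i
  left_inv := by rintro (_ | _ | _ | _) <;> rfl
  right_inv := by rintro ((_ | _) | (_ | _)) <;> rfl

instance finite_half {k : ℕ} (t : TangleDiagram k) : Finite t.Half :=
  Finite.of_equiv _ (HalfEdge.equivSum t.Crossing t.Virtual t.Joint k).symm

theorem rotate_injective {k : ℕ} (t : TangleDiagram k) : Function.Injective t.rotate := by
  rintro (_ | _ | _ | i) (_ | _ | _ | j) h <;>
    simp only [rotate, HalfEdge.crossing.injEq, HalfEdge.virtual.injEq, HalfEdge.joint.injEq,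
      HalfEdge.endpoint.injEq, add_left_inj, EmbeddingLike.apply_eq_iff_eq, reduceCtorEq] at h ⊢ <;>
    exact h

/-- The half-edges of a classical 4-tangle diagram have signs that alternate around all vertices
and along all edges. -/
theorem IsClassical.exists_alternating {t : TangleDiagram 4} (ht : t.IsClassical) :
    ∃ ε : t.Half → ZMod 2, ∀ x, ε (t.rotate x) = ε x + 1 ∧ ε (t.edge x) = ε x + 1 := by
  refine exists_alternating_of_euler t.rotate_injective t.edge_edge t.edge_ne
    -- The index modulo 2 alternates because every vertex has degree 2 or 4.
    (fun x => match x with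
      | .crossing _ i => (i.1 : ZMod 2)
      | .virtual _ i => (i.1 : ZMod 2)
      | .joint _ i => (i.1 : ZMod 2)
      | .endpoint i => (i.1 : ZMod 2)) ?_ ht.2
  rintro (⟨_, i⟩ | ⟨_, i⟩ | ⟨_, i⟩ | i) <;> simp only [rotate] <;> revert i <;> decide

/-- The strands of the state `s` of a 4-tangle diagram, when the end `i` is joined to the end
`μ i`. -/
def strandWith (t : TangleDiagram 4) (μ : Fin 4 → Fin 4) (s : t.Crossing → Bool) : t.Half → t.Half
  | .crossing c i => .crossing c (if s c then ![1, 0, 3, 2] i else ![3, 2, 1, 0] i)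
  | .virtual v i => .virtual v (i + 2)
  | .joint j i => .joint j (i + 1)
  | .endpoint i => .endpoint (μ i)

/-- The number of loops of the state `s` of a 4-tangle diagram, when the end `i` is joined to the
end `μ i`. -/
noncomputable def numLoopsWith (t : TangleDiagram 4) (μ : Fin 4 → Fin 4) (s : t.Crossing → Bool) :
    ℕ :=
  numClasses fun x y : t.Half => y = t.strandWith μ s x ∨ y = t.edge x

theorem numLoopsWith_eq_of_equiv {t : TangleDiagram 4} {l : TangleDiagram 0} {μ : Fin 4 → Fin 4}
    {s : t.Crossing → Bool} {s' : l.Crossing → Bool} (f : t.Half ≃ l.Half)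
    (he : ∀ x, l.edge (f x) = f (t.edge x))
    (hs : ∀ x, l.strand s' (f x) = f (t.strandWith μ s x)) :
    l.numLoops s' = t.numLoopsWith μ s := by
  refine (numClasses_congr f ?_ ?_).symm
  · rintro x y (rfl | rfl)
    · exact Quot.sound (Or.inl (hs x).symm)
    · exact Quot.sound (Or.inr (he x).symm)
  · rintro x y (rfl | rfl)
    · refine Quot.sound (Or.inl ?_)
      rw [f.symm_apply_eq, ← hs, f.apply_symm_apply]
    · refine Quot.sound (Or.inr ?_)
      rw [f.symm_apply_eq, ← he, f.apply_symm_apply]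

/-- Passing the marked point of an arc exchanges its two half-edges, hence the two ends that the arc
joins. -/
theorem numLoops_arcClosure (t : TangleDiagram 4) (e : Fin 4 ≃ Fin 2 × Fin 2)
    (s : t.Crossing → Bool) :
    (t.arcClosure e).numLoops s =
      t.numLoopsWith (fun i => e.symm ((e i).1, (e i).2 + 1)) s := by
  let f : t.Half ≃ HalfEdge t.Crossing t.Virtual (t.Joint ⊕ Fin 2) 0 :=
    { toFun := fun x => match x with
        | .crossing c i => .crossing c i
        | .virtual v i => .virtual v i
        | .joint j i => .joint (.inl j) i
        | .endpoint i => .joint (.inr (e i).1) (e i).2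
      invFun := fun x => match x with
        | .crossing c i => .crossing c i
        | .virtual v i => .virtual v i
        | .joint (.inl j) i => .joint j i
        | .joint (.inr a) b => .endpoint (e.symm (a, b))
        | .endpoint i => i.elim0
      left_inv := by rintro (_ | _ | _ | _) <;> simp
      right_inv := by rintro (_ | _ | ⟨_ | _, _⟩ | i) <;> first | exact i.elim0 | simp }
  refine numLoopsWith_eq_of_equiv (l := t.arcClosure e) f
    (fun x => congrArg (fun y => f (t.edge y)) (f.symm_apply_apply x)) ?_
  rintro (_ | _ | _ | i)
  · rfl
  · rfl
  · rfl
  · change HalfEdge.joint (Sum.inr (e i).1) ((e i).2 + 1) =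
      HalfEdge.joint (Sum.inr (e (e.symm _)).1) (e (e.symm _)).2
    rw [e.apply_symm_apply]

theorem numLoops_numerator (t : TangleDiagram 4) (s : t.Crossing → Bool) :
    t.numerator.numLoops s = t.numLoopsWith ![3, 2, 1, 0] s := by
  refine (numLoops_arcClosure t _ s).trans (congrArg (t.numLoopsWith · s) ?_)
  decide

theorem numLoops_denominator (t : TangleDiagram 4) (s : t.Crossing → Bool) :
    t.denominator.numLoops s = t.numLoopsWith ![1, 0, 3, 2] s := by
  refine (numLoops_arcClosure t _ s).trans (congrArg (t.numLoopsWith · s) ?_)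
  decide

theorem numLoops_virtualClosure (t : TangleDiagram 4) (s : t.Crossing → Bool) :
    t.virtualClosure.numLoops s = t.numLoopsWith ![2, 3, 0, 1] s := by
  let f : t.Half ≃ HalfEdge t.Crossing (Option t.Virtual) t.Joint 0 :=
    { toFun := fun x => match x with
        | .crossing c i => .crossing c i
        | .virtual v i => .virtual (some v) i
        | .joint j i => .joint j i
        | .endpoint i => .virtual none (-i)
      invFun := fun x => match x with
        | .crossing c i => .crossing c i
        | .virtual (some v) i => .virtual v i
        | .virtual none i => .endpoint (-i)
        | .joint j i => .joint j i
        | .endpoint i => i.elim0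
      left_inv := by rintro (_ | _ | _ | _) <;> simp
      right_inv := by rintro (_ | ⟨_ | _, _⟩ | _ | i) <;> first | exact i.elim0 | simp }
  refine numLoopsWith_eq_of_equiv (l := t.virtualClosure) f
    (fun x => congrArg (fun y => f (t.edge y)) (f.symm_apply_apply x)) ?_
  rintro (_ | _ | _ | i)
  · rfl
  · rfl
  · rfl
  · fin_cases i <;> rfl

theorem alternating_endpoint {t : TangleDiagram 4} {ε : t.Half → ZMod 2}
    (hr : ∀ x, ε (t.rotate x) = ε x + 1) (i : Fin 4) :
    ε (.endpoint (i + 1)) = ε (.endpoint i) + 1 := by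
  have h := hr (.endpoint (i + 1))
  rw [rotate, show (finRotate 4).symm (i + 1) = i by clear h; revert i; decide] at h
  rw [h, ZMod.two_add_one_add_one]

section alternating

variable {t : TangleDiagram 4} [IsEmpty t.Virtual] {ε : t.Half → ZMod 2}
  (hr : ∀ x, ε (t.rotate x) = ε x + 1) (he : IsReversing ε t.edge)

include hr

/-- Smoothings and planar closures join neighbours, whose signs differ. The virtual closure joins
ends of equal sign, so its loops are counted by way of open strands instead. -/
theorem isReversing_strandWith {μ : Fin 4 → Fin 4} (hμ : μ = ![3, 2, 1, 0] ∨ μ = ![1, 0, 3, 2])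
    (s : t.Crossing → Bool) : IsReversing ε (t.strandWith μ s) where
  invol := by
    rintro (⟨c, i⟩ | ⟨v, -⟩ | ⟨j, i⟩ | i)
    · simp only [strandWith]
      split_ifs <;> fin_cases i <;> rfl
    · exact isEmptyElim v
    · simp only [strandWith]
      fin_cases i <;> rfl
    · simp only [strandWith]
      rcases hμ with rfl | rfl <;> fin_cases i <;> rfl
  reverse := by
    rintro (⟨c, i⟩ | ⟨v, -⟩ | ⟨j, i⟩ | i)
    · have h0 := hr (.crossing c 0)
      have h1 := hr (.crossing c 1)
      have h2 := hr (.crossing c 2)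
      simp only [rotate, zero_add, Fin.reduceAdd] at h0 h1 h2
      simp only [strandWith]
      split_ifs <;> fin_cases i <;> simp [h0, h1, h2, ZMod.two_add_one_add_one]
    · exact isEmptyElim v
    · exact hr (.joint j i)
    · have h0 := alternating_endpoint hr 0
      have h1 := alternating_endpoint hr 1
      have h2 := alternating_endpoint hr 2
      simp only [zero_add, Fin.reduceAdd] at h0 h1 h2
      simp only [strandWith]
      rcases hμ with rfl | rfl <;> fin_cases i <;> simp [h0, h1, h2, ZMod.two_add_one_add_one]

include he

/-- The parities of the numbers of loops of the two closures by arcs differ. -/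
theorem neg_one_pow_numLoopsWith_denominator (s : t.Crossing → Bool) :
    (-1 : ℤˣ) ^ t.numLoopsWith ![1, 0, 3, 2] s = -(-1) ^ t.numLoopsWith ![3, 2, 1, 0] s := by
  classical
  have h0 := alternating_endpoint hr 0
  have h1 := alternating_endpoint hr 1
  have h2 := alternating_endpoint hr 2
  simp only [zero_add, Fin.reduceAdd] at h0 h1 h2
  -- The ends 0 and 2 have equal signs, and passing from one closure to the other exchanges their
  -- partners 3 and 1.
  refine neg_one_pow_numClasses_of_swap he (isReversing_strandWith hr (Or.inl rfl) s)
    (isReversing_strandWith hr (Or.inr rfl) s) (a := .endpoint 0) (b := .endpoint 2) (by simp)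
    (by rw [h1, h0, ZMod.two_add_one_add_one]) ?_
  rintro (⟨c, i⟩ | ⟨v, i⟩ | ⟨j, i⟩ | i) hx
  · rw [Equiv.swap_apply_of_ne_of_ne (by simp) (by simp)]
    rfl
  · exact isEmptyElim v
  · rw [Equiv.swap_apply_of_ne_of_ne (by simp) (by simp)]
    rfl
  · fin_cases i
    · rw [Fin.mk_zero, Equiv.swap_apply_left]
      rfl
    · exact absurd (h0.symm.trans hx) (ZMod.two_ne_add_one _)
    · exact (congrArg (t.strandWith ![3, 2, 1, 0] s)
        (Equiv.swap_apply_right (.endpoint 0) (.endpoint 2))).symm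
    · exact absurd ((h2.symm.trans hx).trans (by rw [h1, h0, ZMod.two_add_one_add_one]))
        (ZMod.two_ne_add_one _)

/-- Changing the smoothing at one crossing changes the parity of the number of loops. -/
theorem neg_one_pow_numLoopsWith_update (s : t.Crossing → Bool) (c : t.Crossing) :
    (-1 : ℤˣ) ^ t.numLoopsWith ![3, 2, 1, 0] (Function.update s c (!s c)) =
      -(-1) ^ t.numLoopsWith ![3, 2, 1, 0] s := by
  classical
  have h0 := hr (.crossing c 0)
  have h1 := hr (.crossing c 1)
  have h2 := hr (.crossing c 2)
  simp only [rotate, zero_add, Fin.reduceAdd] at h0 h1 h2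
  -- The two smoothings differ by exchanging the partners 1 and 3 of the half-edges 0 and 2, which
  -- have equal signs.
  refine neg_one_pow_numClasses_of_swap he (isReversing_strandWith hr (Or.inl rfl) s)
    (isReversing_strandWith hr (Or.inl rfl) _) (a := .crossing c 0) (b := .crossing c 2) (by simp)
    (by rw [h1, h0, ZMod.two_add_one_add_one]) ?_
  rintro (⟨c', i⟩ | ⟨v, i⟩ | ⟨j, i⟩ | i) hx
  · by_cases hc : c' = c
    · subst hc
      fin_cases i
      · refine Eq.trans ?_ (congrArg (t.strandWith ![3, 2, 1, 0] s) (Equiv.swap_apply_left _ _)).symm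
        cases h : s c' <;> simp [strandWith, h]
      · exact absurd (h0.symm.trans hx) (ZMod.two_ne_add_one _)
      · refine Eq.trans ?_
          (congrArg (t.strandWith ![3, 2, 1, 0] s) (Equiv.swap_apply_right _ _)).symm
        cases h : s c' <;> simp [strandWith, h]
      · exact absurd ((h2.symm.trans hx).trans (by rw [h1, h0, ZMod.two_add_one_add_one]))
          (ZMod.two_ne_add_one _)
    · rw [Equiv.swap_apply_of_ne_of_ne (by simp [hc]) (by simp [hc])]
      simp [strandWith, Function.update_of_ne hc]
  · exact isEmptyElim v
  · rw [Equiv.swap_apply_of_ne_of_ne (by simp) (by simp)]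
    rfl
  · rw [Equiv.swap_apply_of_ne_of_ne (by simp) (by simp)]
    rfl

end alternating

/-! ### Open strands and the three closures -/

/-- The relation on half-edges generated by the edges and the smoothings, where the ends of the
tangle are not joined. -/
def openStrand (t : TangleDiagram 4) (s : t.Crossing → Bool) (x y : t.Half) : Prop :=
  y = t.edge x ∨ x ∉ Set.range HalfEdge.endpoint ∧ y = t.strandWith id s x

theorem strandWith_eq_of_notMem {t : TangleDiagram 4} {s : t.Crossing → Bool} {x : t.Half}
    (hx : x ∉ Set.range HalfEdge.endpoint) (μ ν : Fin 4 → Fin 4) :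
    t.strandWith μ s x = t.strandWith ν s x := by
  rcases x with _ | _ | _ | i
  · rfl
  · rfl
  · rfl
  · exact absurd ⟨i, rfl⟩ hx

open Relation in
theorem numLoopsWith_eq_numClasses_adjoin (t : TangleDiagram 4) (s : t.Crossing → Bool)
    {μ : Fin 4 → Fin 4} {a b c d : Fin 4} (hab : μ a = b) (hba : μ b = a) (hcd : μ c = d)
    (hdc : μ d = c) (h : ∀ i, i = a ∨ i = b ∨ i = c ∨ i = d) :
    t.numLoopsWith μ s = numClasses (adjoin (adjoin (t.openStrand s) (.endpoint a) (.endpoint b))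
      (.endpoint c) (.endpoint d)) := by
  set r := adjoin (adjoin (t.openStrand s) (.endpoint a) (.endpoint b))
    (.endpoint c) (.endpoint d)
  have hopen : ∀ {x y}, t.openStrand s x y → Quot.mk r x = Quot.mk r y := fun h =>
    adjoin_mk_mono _ _ (adjoin_mk_mono _ _ (Quot.sound h))
  have h1 : Quot.mk r (.endpoint a) = Quot.mk r (.endpoint b) :=
    adjoin_mk_mono _ _ (adjoin_mk_eq _ _ _)
  have h2 : Quot.mk r (.endpoint c) = Quot.mk r (.endpoint d) := adjoin_mk_eq _ _ _
  refine numClasses_congr (Equiv.refl _) (fun x y hxy => ?_) (fun x y hxy => ?_)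
  · rcases hxy with rfl | rfl
    · by_cases hx : x ∈ Set.range HalfEdge.endpoint
      · obtain ⟨i, rfl⟩ := hx
        rcases h i with rfl | rfl | rfl | rfl <;> simp only [strandWith, *, Equiv.refl_apply]
      · exact hopen (Or.inr ⟨hx, strandWith_eq_of_notMem hx _ _⟩)
    · exact hopen (Or.inl rfl)
  · rcases hxy with ((rfl | ⟨hx, rfl⟩) | ⟨rfl, rfl⟩) | ⟨rfl, rfl⟩
    · exact Quot.sound (Or.inr rfl)
    · exact Quot.sound (Or.inl (strandWith_eq_of_notMem hx _ _))
    · exact Quot.sound (Or.inl (by simp [strandWith, hab]))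
    · exact Quot.sound (Or.inl (by simp [strandWith, hcd]))

theorem strandWith_mem_range {t : TangleDiagram 4} {s : t.Crossing → Bool} (μ : Fin 4 → Fin 4)
    (x : t.Half) : t.strandWith μ s x ∈ Set.range HalfEdge.endpoint ↔
      x ∈ Set.range HalfEdge.endpoint := by
  rcases x with _ | _ | _ | i <;> simp [strandWith]

/-- In every state, one of the two closures by arcs has as many loops as the virtual closure, and
the other one has one more loop. -/
theorem numLoopsWith_closures {t : TangleDiagram 4} [IsEmpty t.Virtual] {ε : t.Half → ZMod 2}
    (hr : ∀ x, ε (t.rotate x) = ε x + 1) (he : IsReversing ε t.edge) (s : t.Crossing → Bool) :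
    (t.numLoopsWith ![3, 2, 1, 0] s = t.numLoopsWith ![2, 3, 0, 1] s ∧
      t.numLoopsWith ![1, 0, 3, 2] s = t.numLoopsWith ![2, 3, 0, 1] s + 1) ∨
    (t.numLoopsWith ![1, 0, 3, 2] s = t.numLoopsWith ![2, 3, 0, 1] s ∧
      t.numLoopsWith ![3, 2, 1, 0] s = t.numLoopsWith ![2, 3, 0, 1] s + 1) := by
  classical
  have hne : t.numLoopsWith ![3, 2, 1, 0] s ≠ t.numLoopsWith ![1, 0, 3, 2] s := fun h => by
    have h' := neg_one_pow_numLoopsWith_denominator hr he s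
    rw [h] at h'
    exact units_ne_neg_self _ h'
  have bal : ∀ k : Quot (t.openStrand s) → ℤ,
      k (Quot.mk _ (.endpoint 0)) + k (Quot.mk _ (.endpoint 2)) =
        k (Quot.mk _ (.endpoint 1)) + k (Quot.mk _ (.endpoint 3)) := fun k =>
    balanced_ends he (isReversing_strandWith hr (Or.inl rfl) s)
      (p := HalfEdge.endpoint) (fun _ _ h => HalfEdge.endpoint.inj h) (strandWith_mem_range _)
      (alternating_endpoint hr) (fun x => k (Quot.mk _ x))
      (fun x => congrArg k (Quot.sound (r := t.openStrand s) (Or.inl rfl)).symm)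
      (fun x hx => congrArg k (Quot.sound (r := t.openStrand s)
        (Or.inr ⟨hx, strandWith_eq_of_notMem hx _ _⟩)).symm)
  -- Testing `bal` on indicators of classes matches the classes of the even ends with those of the
  -- odd ends.
  have cases : (Quot.mk (t.openStrand s) (.endpoint 0) = Quot.mk _ (.endpoint 1) ∧
        Quot.mk (t.openStrand s) (.endpoint 2) = Quot.mk _ (.endpoint 3)) ∨
      (Quot.mk (t.openStrand s) (.endpoint 0) = Quot.mk _ (.endpoint 3) ∧
        Quot.mk (t.openStrand s) (.endpoint 2) = Quot.mk _ (.endpoint 1)) := by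
    have h0 := bal fun q => if q = Quot.mk _ (.endpoint 0) then 1 else 0
    have h2 := bal fun q => if q = Quot.mk _ (.endpoint 2) then 1 else 0
    grind
  rcases cases with ⟨h01, h23⟩ | ⟨h03, h21⟩
  · left
    have hn := numLoopsWith_eq_numClasses_adjoin t s (μ := ![3, 2, 1, 0]) (a := 0) (b := 3)
      (c := 1) (d := 2) rfl rfl rfl rfl (by decide)
    have hd := numLoopsWith_eq_numClasses_adjoin t s (μ := ![1, 0, 3, 2]) (a := 0) (b := 1)
      (c := 2) (d := 3) rfl rfl rfl rfl (by decide)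
    have hv := numLoopsWith_eq_numClasses_adjoin t s (μ := ![2, 3, 0, 1]) (a := 0) (b := 2)
      (c := 1) (d := 3) rfl rfl rfl rfl (by decide)
    rw [hn, hd] at hne
    rw [hn, hd, hv]
    exact numClasses_adjoin_of_paired h01 h23 hne
  · right
    have hn := numLoopsWith_eq_numClasses_adjoin t s (μ := ![3, 2, 1, 0]) (a := 0) (b := 3)
      (c := 2) (d := 1) rfl rfl rfl rfl (by decide)
    have hd := numLoopsWith_eq_numClasses_adjoin t s (μ := ![1, 0, 3, 2]) (a := 0) (b := 1)
      (c := 3) (d := 2) rfl rfl rfl rfl (by decide)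
    have hv := numLoopsWith_eq_numClasses_adjoin t s (μ := ![2, 3, 0, 1]) (a := 0) (b := 2)
      (c := 3) (d := 1) rfl rfl rfl rfl (by decide)
    rw [hn, hd] at hne
    rw [hn, hd, hv]
    exact numClasses_adjoin_of_paired h03 h21 hne.symm

end TangleDiagram

/-! ### State sums and reduction modulo `δ + 1` -/

namespace TangleDiagram

open LaurentPolynomial

/-- The value `-A² - A⁻²` of a circle. -/
noncomputable def loopValue : LaurentPolynomial ℤ := -T 2 - T (-2)

/-- The weight of the smoothings of a state. -/
noncomputable def stateWeight {C : Type} [Fintype C] (s : C → Bool) : LaurentPolynomial ℤ :=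
  T (∑ c, if s c then (1 : ℤ) else -1)

theorem stateWeight_eq_prod {C : Type} [Fintype C] (s : C → Bool) :
    stateWeight s = ∏ c, (if s c then T 1 else T (-1) : LaurentPolynomial ℤ) := by
  classical
  rw [stateWeight]
  induction (Finset.univ : Finset C) using Finset.induction_on with
  | empty => simp
  | insert c S hc ih =>
    rw [Finset.sum_insert hc, Finset.prod_insert hc, T_add, ih]
    split_ifs <;> rfl

theorem bracket_numerator (t : TangleDiagram 4) : t.numerator.bracket =
    ∑ s, stateWeight s * loopValue ^ (t.numLoopsWith ![3, 2, 1, 0] s - 1) :=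
  Finset.sum_congr rfl fun s _ =>
    congrArg (fun m => stateWeight s * loopValue ^ (m - 1)) (numLoops_numerator t s)

theorem bracket_denominator (t : TangleDiagram 4) : t.denominator.bracket =
    ∑ s, stateWeight s * loopValue ^ (t.numLoopsWith ![1, 0, 3, 2] s - 1) :=
  Finset.sum_congr rfl fun s _ =>
    congrArg (fun m => stateWeight s * loopValue ^ (m - 1)) (numLoops_denominator t s)

theorem bracket_virtualClosure (t : TangleDiagram 4) : t.virtualClosure.bracket =
    ∑ s, stateWeight s * loopValue ^ (t.numLoopsWith ![2, 3, 0, 1] s - 1) :=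
  Finset.sum_congr rfl fun s _ =>
    congrArg (fun m => stateWeight s * loopValue ^ (m - 1)) (numLoops_virtualClosure t s)

theorem numLoopsWith_pos (t : TangleDiagram 4) (μ : Fin 4 → Fin 4) (s : t.Crossing → Bool) :
    0 < t.numLoopsWith μ s :=
  have : Nonempty (Quot fun x y : t.Half => y = t.strandWith μ s x ∨ y = t.edge x) :=
    ⟨Quot.mk _ (.endpoint 0)⟩
  Nat.card_pos

section alternating

variable {t : TangleDiagram 4} [IsEmpty t.Virtual] {ε : t.Half → ZMod 2}
  (hr : ∀ x, ε (t.rotate x) = ε x + 1) (he : IsReversing ε t.edge)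
include hr he

theorem bracket_numerator_add_bracket_denominator :
    t.numerator.bracket + t.denominator.bracket =
      (loopValue + 1) * t.virtualClosure.bracket := by
  rw [bracket_numerator, bracket_denominator, bracket_virtualClosure, Finset.mul_sum,
    ← Finset.sum_add_distrib]
  refine Finset.sum_congr rfl fun s _ => ?_
  -- Positivity makes the truncated exponent a true `m - 1`; the two closures by arcs contribute `δ
  -- ^ m` and `δ ^ (m + 1)`, the virtual one `δ ^ m`.
  obtain ⟨m, hm⟩ := Nat.exists_eq_add_of_lt (t.numLoopsWith_pos ![2, 3, 0, 1] s)
  rcases numLoopsWith_closures hr he s with ⟨h1, h2⟩ | ⟨h1, h2⟩ <;>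
  · rw [h1, h2, hm]
    simp only [zero_add, Nat.add_sub_cancel, pow_succ]
    ring

/-- The parity of the number of loops of a state is given by the number of its smoothings of each
kind. -/
theorem neg_one_pow_numLoopsWith (s : t.Crossing → Bool) :
    (-1 : ℤˣ) ^ t.numLoopsWith ![3, 2, 1, 0] s =
      (-1) ^ t.numLoopsWith ![3, 2, 1, 0] (fun _ => true) * ∏ c, if s c then 1 else -1 := by
  -- `S` is the set of crossings with an `A⁻¹`-smoothing, switched one at a time from the all-`A`
  -- state.
  have key : ∀ S : Finset t.Crossing, (-1 : ℤˣ) ^ t.numLoopsWith ![3, 2, 1, 0]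
      (fun c => decide (c ∉ S)) =
      (-1) ^ t.numLoopsWith ![3, 2, 1, 0] (fun _ => true) * (-1) ^ S.card := by
    intro S
    induction S using Finset.induction_on with
    | empty => simp
    | insert c S hc ih =>
      have hu : (fun c' => decide (c' ∉ insert c S)) =
          Function.update (fun c' => decide (c' ∉ S)) c (!decide (c ∉ S)) := by
        funext c'
        by_cases h : c' = c
        · subst h; simp [hc]
        · simp [h]
      rw [hu, neg_one_pow_numLoopsWith_update hr he _ c, ih, Finset.card_insert_of_notMem hc,
        pow_succ]
      simp
  have h := key {c | s c = false}
  simp only [Finset.mem_filter, Finset.mem_univ, true_and, Bool.not_eq_false, Bool.decide_eq_true]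
    at h
  rw [h, Finset.prod_ite]
  simp

/-- In every quotient of the ring of Laurent polynomials in which the value of a circle is `-1`, the
bracket of the numerator closure is a unit. -/
theorem isUnit_map_bracket_numerator {R : Type*} [CommRing R] (q : LaurentPolynomial ℤ →+* R)
    (hq : q loopValue = -1) : IsUnit (q t.numerator.bracket) := by
  have hu : IsUnit (q (T 1 - T (-1))) := by
    -- The square of `A - A⁻¹` is `-δ - 2`, which `q` sends to `-1`.
    refine IsUnit.of_mul_eq_one (-q (T 1 - T (-1))) ?_
    have h : (T 1 - T (-1)) * (T 1 - T (-1)) = (-loopValue - 2 : LaurentPolynomial ℤ) := by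
      have h1 : (T 1 * T (-1) : LaurentPolynomial ℤ) = 1 := by rw [← T_add]; simp
      have h2 : (T 1 * T 1 : LaurentPolynomial ℤ) = T 2 := by rw [← T_add]; rfl
      have h3 : (T (-1) * T (-1) : LaurentPolynomial ℤ) = T (-2) := by rw [← T_add]; rfl
      rw [loopValue]
      linear_combination h2 + h3 - 2 * h1
    rw [mul_neg, ← map_mul, h]
    simp only [map_sub, map_neg, hq, map_ofNat]
    ring
  have key : q t.numerator.bracket =
      -(((-1 : ℤˣ) ^ t.numLoopsWith ![3, 2, 1, 0] (fun _ => true) : ℤˣ) : ℤ) *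
        q (T 1 - T (-1)) ^ Fintype.card t.Crossing := by
    have hs : ∀ s, q (stateWeight s * loopValue ^ (t.numLoopsWith ![3, 2, 1, 0] s - 1)) =
        -(((-1 : ℤˣ) ^ t.numLoopsWith ![3, 2, 1, 0] (fun _ => true) : ℤˣ) : ℤ) *
          ∏ c, (if s c then q (T 1) else -q (T (-1))) := by
      intro s
      have h1 : (-1 : R) ^ (t.numLoopsWith ![3, 2, 1, 0] s - 1) =
          -(((-1 : ℤˣ) ^ t.numLoopsWith ![3, 2, 1, 0] s : ℤˣ) : ℤ) := by
        obtain ⟨m, hm⟩ := Nat.exists_eq_add_of_lt (t.numLoopsWith_pos ![3, 2, 1, 0] s)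
        rw [hm]
        simp [pow_succ]
      rw [map_mul, map_pow, hq, h1, neg_one_pow_numLoopsWith hr he s, stateWeight_eq_prod, map_prod]
      simp only [Units.val_mul, Int.cast_mul, Units.coe_prod, Int.cast_prod]
      rw [← neg_mul, mul_left_comm, ← Finset.prod_mul_distrib]
      congr 1
      refine Finset.prod_congr rfl fun c _ => ?_
      split_ifs <;> simp
    -- A sum over states of a product over crossings is the product of the two-term sums `q A - q
    -- A⁻¹`.
    rw [bracket_numerator, map_sum, Finset.sum_congr rfl fun s _ => hs s, ← Finset.mul_sum,
      ← Fintype.prod_sum fun (_ : t.Crossing) (b : Bool) => if b then q (T 1) else -q (T (-1))]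
    simp [sub_eq_add_neg]
  rw [key]
  refine IsUnit.mul (IsUnit.neg ?_) (hu.pow _)
  exact (Units.isUnit _).map (Int.castRingHom R)

end alternating

end TangleDiagram

/-! ### Equality of the ideals -/

open TangleDiagram in
theorem proposition5p7 (t : TangleDiagram 4) (ht : t.IsClassical) :
    t.bracketIdeal = t.virtualBracketIdeal := by
  have := ht.1
  obtain ⟨ε, hε⟩ := ht.exists_alternating
  have hr := fun x => (hε x).1
  have he : IsReversing ε t.edge := ⟨t.edge_edge, fun x => (hε x).2⟩
  have hn : t.numerator.bracket ∈ t.bracketIdeal := Ideal.subset_span (by simp)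
  have hd : t.denominator.bracket ∈ t.bracketIdeal := Ideal.subset_span (by simp)
  refine le_antisymm (Ideal.span_mono (by grind)) (Ideal.span_le.2 ?_)
  rintro _ (rfl | rfl | rfl)
  · exact hn
  · exact hd
  have hu := isUnit_map_bracket_numerator hr he (Ideal.Quotient.mk (Ideal.span {loopValue + 1})) (by
    rw [eq_neg_iff_add_eq_zero, ← map_one (Ideal.Quotient.mk _), ← map_add,
      Ideal.Quotient.eq_zero_iff_mem]
    exact Ideal.mem_span_singleton_self _)
  obtain ⟨w, hw⟩ := hu.exists_right_inv
  obtain ⟨w, rfl⟩ := Ideal.Quotient.mk_surjective w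
  rw [← map_mul, ← map_one (Ideal.Quotient.mk _), Ideal.Quotient.eq,
    Ideal.mem_span_singleton] at hw
  obtain ⟨h, hw⟩ := hw
  have hsum := bracket_numerator_add_bracket_denominator hr he
  -- This is `hw` times `⟨t^v⟩`, with `(δ + 1)⟨t^v⟩` replaced by means of `hsum`.
  have : t.virtualClosure.bracket = (w * t.virtualClosure.bracket) * t.numerator.bracket -
      h * (t.numerator.bracket + t.denominator.bracket) := by
    rw [hsum]
    linear_combination -t.virtualClosure.bracket * hw
  rw [this]
  exact sub_mem (Ideal.mul_mem_left _ _ hn) (Ideal.mul_mem_left _ _ (add_mem hn hd))
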